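/- All digraphs are finite and nonempty and have no loops and no repeated edges; two edges in opposite directions between the same pair of vertices are allowed. An oriented tree is an orientation of a finite undirected tree. A height function of an oriented tree $T$ is a map $h_T\colon V(T)\to\mathbb{Z}$ with $h_T(v)=h_T(u)+1$ for every edge $(u,v)$ (directed from $u$ to $v$); it exists and is unique up to an additive constant. The tree $T$ is grounded if $h_T$ is constant on the set of vertices of in-degree at least $2$. The tree $T$ is $\delta^+$-enforcible if there is an integer $d=d(T)\ge 0$ such that every digraph $G$ in which each vertex has out-degree at least $d$ contains $T$ as a (not necessarily induced) subgraph. Corollary. Every grounded oriented tree with at most two vertices of in-degree at least $2$ is $\delta^+$-enforcible. -/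

import Mathlib

universe u v

namespace Digraph

/-- The in-degree of `x`: the number of `w` with an edge from `w` to `x`. -/
noncomputable def inDegree {V : Type u} (G : Digraph V) (x : V) : ℕ :=
  {w : V | G.Adj w x}.ncard

/-- The out-degree of `x`: the number of `w` with an edge from `x` to `w`. -/
noncomputable def outDegree {V : Type u} (G : Digraph V) (x : V) : ℕ :=
  {w : V | G.Adj x w}.ncard

/-- The minimum out-degree of a digraph (used for finite nonempty vertex sets). -/
noncomputable def minOutDegree {V : Type u} (G : Digraph V) : ℕ :=
  ⨅ x : V, G.outDegree x

/-- No edge joins a vertex to itself. -/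
def Loopless {V : Type u} (G : Digraph V) : Prop :=
  ∀ x : V, ¬ G.Adj x x

/-- `G` contains `H` as a (not necessarily induced) subgraph. -/
def ContainsSubgraph {W : Type v} {V : Type u} (G : Digraph W) (H : Digraph V) : Prop :=
  ∃ f : V → W, Function.Injective f ∧ ∀ x y : V, H.Adj x y → G.Adj (f x) (f y)

/-- An orientation of an undirected tree: each pair of vertices carries at most one edge (in
particular there are no loops), and forgetting the directions leaves a tree. -/
def IsOrientedTree {V : Type u} (T : Digraph V) : Prop :=
  (∀ x y : V, T.Adj x y → ¬ T.Adj y x) ∧ T.toSimpleGraphInclusive.IsTree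

/-- `h` increases by exactly one along every edge. -/
def IsHeightFunction {V : Type u} (T : Digraph V) (h : V → ℤ) : Prop :=
  ∀ x y : V, T.Adj x y → h y = h x + 1

/-- The height function is constant on the vertices of in-degree at least two. An oriented tree
has a height function, and any two differ by an additive constant, so it does not matter which
height function is taken. -/
def IsGrounded {V : Type u} (T : Digraph V) : Prop :=
  ∃ h : V → ℤ, T.IsHeightFunction h ∧
    ∀ x y : V, 2 ≤ T.inDegree x → 2 ≤ T.inDegree y → h x = h y

/-- Some `d` is such that every finite (nonempty, loopless) digraph of minimum out-degree at
least `d` contains `T` as a subgraph. -/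
def IsOutDegreeEnforcible {V : Type u} (T : Digraph V) : Prop :=
  ∃ d : ℕ, ∀ (W : Type v) [Finite W] [Nonempty W] (G : Digraph W),
    G.Loopless → d ≤ G.minOutDegree → G.ContainsSubgraph T

end Digraph

/-! Let `K` bound the height differences in `T`, and call a vertex rich if few other vertices cannot
hit all paths of length `K` ending there. Large out-degree forces a rich vertex. Otherwise every
vertex has a small hitting set, which limits the locally self-avoiding walks ending there to about
`(2 * e) ^ n`. In an out-regular digraph of degree `4 * e` there are at least `(3 * e) ^ n` such
walks, a contradiction (`exists_forall_path_avoiding`). This applies inside every subset of large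
out-degree, so the rich vertices are unavoidable, and unavoidability passes to the vertices with
many out-neighbours in an unavoidable set (`IsUnavoidable.le_outNeighbors`). Hence there are wide
out-branchings of prescribed depth all of whose ends are rich.

In `T`, let `u` and `v` include all vertices of in-degree at least two, and let `r` be a common
ancestor of least height. The directed paths from `r` to `u` or `v` form a part `Q` that embeds
greedily in such a branching. As `T` is grounded, `u` and `v` lie at the same depth and both become
rich. Only `u` and `v` can miss in-neighbours in `Q`. The ancestors of such an in-neighbour form a
directed path, which is placed on a fresh path into the rich vertex. All else is attached greedily
along out-edges. -/

namespace Digraph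

/-! ### Counting walks that are self-avoiding over short ranges. -/

section LocalPaths

variable {α : Type u} [DecidableEq α]

/-- The admissible continuations of a walk, listed from its last vertex backwards: the
out-neighbours of the last vertex that are not among the last `K` vertices. -/
def walkExt (N : α → Finset α) (K : ℕ) : List α → Finset α
  | [] => ∅
  | b :: l => N b \ ((b :: l).take K).toFinset

/-- The walks with `n` edges that do not return to a vertex within `K` steps, each listed from its
last vertex backwards. -/
def localPaths [Fintype α] (N : α → Finset α) (K : ℕ) : ℕ → Finset (List α)
  | 0 => Finset.univ.image fun a => [a]
  | n + 1 => (localPaths N K n).biUnion fun l => (walkExt N K l).image fun b => b :: l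

variable {N : α → Finset α} {K : ℕ}

lemma mem_of_mem_walkExt {l : List α} {a b : α} (hb : b ∈ walkExt N K l) (ha : l[0]? = some a) :
    b ∈ N a := by
  cases l with
  | nil => simp at ha
  | cons c l =>
    simp only [List.getElem?_cons_zero, Option.some.injEq] at ha
    subst ha
    exact (Finset.mem_sdiff.1 hb).1

lemma notMem_take_of_mem_walkExt {l : List α} {b : α} (hb : b ∈ walkExt N K l) :
    b ∉ l.take K := by
  cases l with
  | nil => simp
  | cons c l => simpa using (Finset.mem_sdiff.1 hb).2

lemma card_walkExt_le {d : ℕ} (hN : ∀ a, (N a).card = d) (l : List α) :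
    (walkExt N K l).card ≤ d := by
  cases l with
  | nil => simp [walkExt]
  | cons b l => exact (Finset.card_le_card Finset.sdiff_subset).trans (hN b).le

variable [Fintype α]

lemma mem_localPaths_zero {l : List α} : l ∈ localPaths N K 0 ↔ ∃ a, l = [a] := by
  simp [localPaths, eq_comm]

lemma mem_localPaths_succ {n : ℕ} {l : List α} :
    l ∈ localPaths N K (n + 1) ↔
      ∃ l' ∈ localPaths N K n, ∃ b ∈ walkExt N K l', l = b :: l' := by
  simp [localPaths, eq_comm]

lemma length_of_mem_localPaths {n : ℕ} {l : List α} (hl : l ∈ localPaths N K n) :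
    l.length = n + 1 := by
  induction n generalizing l with
  | zero => obtain ⟨a, rfl⟩ := mem_localPaths_zero.1 hl; rfl
  | succ n ih =>
    obtain ⟨l', hl', b, -, rfl⟩ := mem_localPaths_succ.1 hl
    simp [ih hl']

lemma adj_of_mem_localPaths {n : ℕ} {l : List α} (hl : l ∈ localPaths N K n) {i : ℕ} {a b : α}
    (ha : l[i]? = some a) (hb : l[i + 1]? = some b) : a ∈ N b := by
  induction n generalizing l i with
  | zero => obtain ⟨a, rfl⟩ := mem_localPaths_zero.1 hl; simp at hb
  | succ n ih =>
    obtain ⟨l', hl', c, hc, rfl⟩ := mem_localPaths_succ.1 hl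
    cases i with
    | zero =>
      simp only [List.getElem?_cons_zero, Option.some.injEq] at ha
      subst ha
      exact mem_of_mem_walkExt hc (by simpa using hb)
    | succ i => exact ih hl' (by simpa using ha) (by simpa using hb)

lemma ne_of_mem_localPaths {n : ℕ} {l : List α} (hl : l ∈ localPaths N K n) {i j : ℕ} {a b : α}
    (ha : l[i]? = some a) (hb : l[j]? = some b) (hij : i < j) (hj : j ≤ i + K) : a ≠ b := by
  induction n generalizing l i j with
  | zero =>
    obtain ⟨a, rfl⟩ := mem_localPaths_zero.1 hl
    obtain ⟨j, rfl⟩ := Nat.exists_eq_add_of_lt hij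
    simp at hb
  | succ n ih =>
    obtain ⟨l', hl', c, hc, rfl⟩ := mem_localPaths_succ.1 hl
    obtain ⟨j, rfl⟩ : ∃ k, j = k + 1 := ⟨j - 1, by omega⟩
    cases i with
    | zero =>
      simp only [List.getElem?_cons_zero, Option.some.injEq] at ha
      subst ha
      rintro rfl
      refine notMem_take_of_mem_walkExt hc (List.mem_iff_getElem?.2 ⟨j, ?_⟩)
      rw [List.getElem?_take_of_lt (by omega)]
      simpa using hb
    | succ i => exact ih hl' (by simpa using ha) (by simpa using hb) (by omega) (by omega)

lemma le_card_walkExt {d n : ℕ} (hN : ∀ a, (N a).card = d) {l : List α}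
    (hl : l ∈ localPaths N K n) : d - K ≤ (walkExt N K l).card := by
  cases l with
  | nil => simpa using length_of_mem_localPaths hl
  | cons b l =>
    have h1 := Finset.le_card_sdiff ((b :: l).take K).toFinset (N b)
    have h2 : ((b :: l).take K).toFinset.card ≤ K :=
      (List.toFinset_card_le _).trans (List.length_take_le _ _)
    rw [hN b] at h1
    change _ ≤ (N b \ ((b :: l).take K).toFinset).card
    omega

lemma card_localPaths_succ (n : ℕ) :
    (localPaths N K (n + 1)).card = ∑ l ∈ localPaths N K n, (walkExt N K l).card := by
  rw [localPaths, Finset.card_biUnion]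
  · refine Finset.sum_congr rfl fun l _ => Finset.card_image_of_injective _ fun a b h => ?_
    simpa using h
  · intro l _ l' _ hne
    refine Finset.disjoint_left.2 ?_
    intro m hm hm'
    simp only [Finset.mem_image] at hm hm'
    obtain ⟨b, -, rfl⟩ := hm
    obtain ⟨b', -, h⟩ := hm'
    exact hne (List.cons.inj h).2.symm

lemma pow_le_card_localPaths [Nonempty α] {d : ℕ} (hN : ∀ a, (N a).card = d) (n : ℕ) :
    (d - K) ^ n ≤ (localPaths N K n).card := by
  induction n with
  | zero =>
    rw [pow_zero, Nat.one_le_iff_ne_zero, ← Nat.pos_iff_ne_zero, Finset.card_pos]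
    exact ⟨[Classical.arbitrary α], mem_localPaths_zero.2 ⟨_, rfl⟩⟩
  | succ n ih =>
    rw [card_localPaths_succ, pow_succ]
    calc (d - K) ^ n * (d - K) ≤ (localPaths N K n).card * (d - K) := by gcongr
      _ = ∑ l ∈ localPaths N K n, (d - K) := by simp
      _ ≤ _ := Finset.sum_le_sum fun l hl => le_card_walkExt hN hl

/-- Each of the `j` steps after the first `n` has at most `d` choices. -/
lemma card_filter_drop_le {d : ℕ} (hN : ∀ a, (N a).card = d) (P : List α → Prop)
    [DecidablePred P] (n j : ℕ) :
    {l ∈ localPaths N K (n + j) | P (l.drop j)}.card ≤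
      d ^ j * {l ∈ localPaths N K n | P l}.card := by
  induction j with
  | zero => simp
  | succ j ih =>
    have hsub : {l ∈ localPaths N K (n + (j + 1)) | P (l.drop (j + 1))} ⊆
        {l ∈ localPaths N K (n + j) | P (l.drop j)}.biUnion
          fun l => (walkExt N K l).image fun b => b :: l := by
      intro l hl
      rw [Finset.mem_filter, ← add_assoc, mem_localPaths_succ] at hl
      obtain ⟨⟨l', hl', b, hb, rfl⟩, hP⟩ := hl
      simp only [List.drop_succ_cons] at hP
      simp only [Finset.mem_biUnion, Finset.mem_filter, Finset.mem_image]
      exact ⟨l', ⟨hl', hP⟩, b, hb, rfl⟩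
    calc _ ≤ _ := Finset.card_le_card hsub
      _ ≤ {l ∈ localPaths N K (n + j) | P (l.drop j)}.card * d :=
        Finset.card_biUnion_le_card_mul _ _ _ fun l _ =>
          Finset.card_image_le.trans (card_walkExt_le hN l)
      _ ≤ d ^ j * {l ∈ localPaths N K n | P l}.card * d := by gcongr
      _ = _ := by ring

lemma card_localPaths_le {d : ℕ} (hN : ∀ a, (N a).card = d) (n : ℕ) :
    (localPaths N K n).card ≤ d ^ n * Fintype.card α := by
  have h := card_filter_drop_le (K := K) hN (fun _ => True) 0 n
  simp only [Finset.filter_true, zero_add] at h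
  refine h.trans (Nat.mul_le_mul_left _ ?_)
  exact Finset.card_image_le

/-- The prescribed end `v` determines the last of the `j + 1` steps, so only `j` steps are free.
This saved factor `d` drives the upper bound on walks. -/
lemma card_filter_head_drop_le {d : ℕ} (hN : ∀ a, (N a).card = d) (P : List α → Prop)
    [DecidablePred P] (n j : ℕ) (v : α) :
    {l ∈ localPaths N K (n + (j + 1)) | l[0]? = some v ∧ P (l.drop (j + 1))}.card ≤
      d ^ j * {l ∈ localPaths N K n | P l}.card := by
  refine le_trans ?_ (card_filter_drop_le hN P n j)
  refine Finset.card_le_card_of_injOn List.tail ?_ ?_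
  · intro l hl
    simp only [Finset.coe_filter, Set.mem_ofPred_eq, ← add_assoc, mem_localPaths_succ] at hl ⊢
    obtain ⟨⟨l', hl', b, -, rfl⟩, -, hP⟩ := hl
    exact ⟨hl', by simpa using hP⟩
  · intro l hl m hm h
    simp only [Finset.coe_filter, Set.mem_ofPred_eq, ← add_assoc, mem_localPaths_succ] at hl hm
    obtain ⟨⟨l', -, b, -, rfl⟩, hv, -⟩ := hl
    obtain ⟨⟨m', -, c, -, rfl⟩, hv', -⟩ := hm
    simp only [List.getElem?_cons_zero, Option.some.injEq] at hv hv'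
    simp only [List.tail_cons] at h
    rw [hv, hv', h]

/-- In an out-regular digraph of large out-degree the paths of length `K` that end at a suitable
vertex cannot be hit by few other vertices. -/
theorem exists_forall_path_avoiding [Nonempty α] {e L : ℕ} (hN : ∀ a, (N a).card = 4 * e)
    (hK : K ≤ e) (hL : L * 2 ^ K ≤ 2 * e) (he : 0 < e) :
    ∃ v : α, ∀ F : Finset α, F.card ≤ L → ∃ q : ℕ → α, q 0 = v ∧
      (∀ j < K, q j ∈ N (q (j + 1))) ∧ (∀ i ≤ K, ∀ j ≤ K, q i = q j → i = j) ∧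
      ∀ j, 1 ≤ j → j ≤ K → q j ∉ F := by
  by_contra! hcon
  -- `F v` is a small set hitting every path of length `K` that ends at `v`.
  choose F hFcard hF using hcon
  set A := (4 * e) ^ K * Fintype.card α
  have key : ∀ n v, {l ∈ localPaths N K n | l[0]? = some v}.card ≤ A * (2 * e) ^ n := by
    intro n
    induction n using Nat.strong_induction_on with
    | _ n ih =>
    intro v
    rcases lt_or_ge n K with hn | hn
    · calc _ ≤ (localPaths N K n).card := Finset.card_filter_le _ _
        _ ≤ (4 * e) ^ n * Fintype.card α := card_localPaths_le hN n
        _ ≤ (4 * e) ^ K * Fintype.card α := by gcongr; omega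
        _ ≤ A * (2 * e) ^ n := Nat.le_mul_of_pos_right _ (by positivity)
    -- The last `K + 1` vertices of such a walk form a path ending at `v`, so `F v` contains the
    -- vertex `i + 1` steps before the end for some `i < K`.
    have hsub : {l ∈ localPaths N K n | l[0]? = some v} ⊆
        (Finset.range K).biUnion fun i => (F v).biUnion fun x =>
          {l ∈ localPaths N K n | l[0]? = some v ∧ (l.drop (i + 1))[0]? = some x} := by
      intro l hl
      rw [Finset.mem_filter] at hl
      obtain ⟨hl, hv⟩ := hl
      have hlen := length_of_mem_localPaths hl
      have hget : ∀ i ≤ K, l[i]? = some (l.getD i v) := by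
        intro i hi
        rw [List.getD_eq_getElem?_getD, List.getElem?_eq_getElem (by omega)]
        rfl
      obtain ⟨j, hj1, hjK, hj⟩ := hF v (fun i => l.getD i v)
        (by simp [List.getD_eq_getElem?_getD, hv])
        (fun j hj => adj_of_mem_localPaths hl (hget j (by omega)) (hget (j + 1) (by omega)))
        (by
          intro i hi j hj hij
          by_contra hne
          rcases lt_or_gt_of_ne hne with h | h
          · exact ne_of_mem_localPaths hl (hget i hi) (hget j hj) h (by omega) hij
          · exact ne_of_mem_localPaths hl (hget j hj) (hget i hi) h (by omega) hij.symm)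
      simp only [Finset.mem_biUnion, Finset.mem_filter, Finset.mem_range]
      refine ⟨j - 1, by omega, _, hj, hl, hv, ?_⟩
      rw [Nat.sub_add_cancel hj1, List.getElem?_drop, add_zero]
      exact hget j hjK
    rcases Nat.eq_zero_or_pos K with rfl | hKpos
    · rw [Finset.range_zero, Finset.biUnion_empty, Finset.subset_empty] at hsub
      simp [hsub]
    calc _ ≤ _ := Finset.card_le_card hsub
      _ ≤ ∑ i ∈ Finset.range K, ∑ x ∈ F v, A * (2 * e) ^ (n - 1) * 2 ^ i := by
        refine Finset.card_biUnion_le.trans (Finset.sum_le_sum fun i hi => ?_)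
        refine Finset.card_biUnion_le.trans (Finset.sum_le_sum fun x _ => ?_)
        rw [Finset.mem_range] at hi
        obtain ⟨m, rfl⟩ : ∃ m, n = m + (i + 1) := ⟨n - (i + 1), by omega⟩
        refine (card_filter_head_drop_le hN (fun l => l[0]? = some x) m i v).trans ?_
        calc _ ≤ (4 * e) ^ i * (A * (2 * e) ^ m) :=
              Nat.mul_le_mul_left _ (ih m (by omega) x)
          _ = _ := by
              rw [show m + (i + 1) - 1 = m + i by omega, pow_add, show 4 * e = 2 * (2 * e) by ring,
                mul_pow 2 (2 * e)]
              ring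
      _ ≤ ∑ i ∈ Finset.range K, L * (A * (2 * e) ^ (n - 1) * 2 ^ i) := by
        refine Finset.sum_le_sum fun i _ => ?_
        rw [Finset.sum_const, smul_eq_mul]
        exact Nat.mul_le_mul_right _ (hFcard v)
      _ = A * (2 * e) ^ (n - 1) * (L * ∑ i ∈ Finset.range K, 2 ^ i) := by
        rw [Finset.mul_sum, Finset.mul_sum]
        exact Finset.sum_congr rfl fun i _ => by ring
      _ ≤ A * (2 * e) ^ (n - 1) * (2 * e) := by
        refine Nat.mul_le_mul_left _ (le_trans (Nat.mul_le_mul_left _ ?_) hL)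
        exact (Nat.geomSum_lt le_rfl (by simp)).le
      _ = A * (2 * e) ^ n := by
        rw [mul_assoc, ← pow_succ, Nat.sub_add_cancel (by omega)]
  have upper : ∀ n, (localPaths N K n).card ≤ Fintype.card α * (A * (2 * e) ^ n) := by
    intro n
    have hsub : localPaths N K n ⊆
        Finset.univ.biUnion fun v => {l ∈ localPaths N K n | l[0]? = some v} := by
      intro l hl
      have hlen := length_of_mem_localPaths hl
      simp only [Finset.mem_biUnion, Finset.mem_univ, true_and, Finset.mem_filter]
      exact ⟨l[0], hl, List.getElem?_eq_getElem (by omega)⟩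
    exact (Finset.card_le_card hsub).trans
      (Finset.card_biUnion_le_card_mul _ _ _ fun v _ => key n v)
  -- The lower bound `(3 * e) ^ n` outgrows the upper bound by the factor `(3 / 2) ^ n`.
  obtain ⟨n, hn⟩ : ∃ n : ℕ, ((Fintype.card α * A : ℕ) : ℝ) < (3 / 2 : ℝ) ^ n :=
    pow_unbounded_of_one_lt _ (by norm_num)
  have hlow : (3 * e) ^ n ≤ (localPaths N K n).card :=
    (Nat.pow_le_pow_left (by omega) n).trans (pow_le_card_localPaths hN n)
  have h : (((3 * e) ^ n : ℕ) : ℝ) ≤ ((Fintype.card α * (A * (2 * e) ^ n) : ℕ) : ℝ) := by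
    exact_mod_cast hlow.trans (upper n)
  have hpos : (0 : ℝ) < (2 * e : ℝ) ^ n := by positivity
  have h' : ((3 : ℝ) * e) ^ n = (3 / 2 : ℝ) ^ n * (2 * e : ℝ) ^ n := by
    rw [← mul_pow]; congr 1; ring
  push_cast at h hn
  rw [h', ← mul_assoc] at h
  exact absurd (le_of_mul_le_mul_right h hpos) (not_le.2 hn)

end LocalPaths

/-! ### Rich vertices and unavoidable sets. -/

/-- The paths of length `K` that end at `x` cannot be hit by `L` vertices other than `x`. -/
def IsRich {W : Type u} (G : Digraph W) (K L : ℕ) (x : W) : Prop :=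
  ∀ F : Finset W, F.card ≤ L → ∃ q : ℕ → W, q 0 = x ∧
    (∀ j < K, G.Adj (q (j + 1)) (q j)) ∧ (∀ i ≤ K, ∀ j ≤ K, q i = q j → i = j) ∧
    ∀ j, 1 ≤ j → j ≤ K → q j ∉ F

/-- Every nonempty set of vertices inside which all out-degrees are at least `d` meets `R`. -/
def IsUnavoidable {W : Type u} (G : Digraph W) (d : ℕ) (R : Set W) : Prop :=
  ∀ C : Set W, C.Nonempty → (∀ x ∈ C, d ≤ {y | G.Adj x y ∧ y ∈ C}.ncard) → (C ∩ R).Nonempty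

/-- Out-neighbourhoods inside `C` are thinned to size exactly `4 * e`. Paths found inside `C` avoid
`F` as soon as they avoid its trace on `C`. -/
theorem isUnavoidable_isRich {W : Type u} [Finite W] (G : Digraph W) {K L e : ℕ}
    (hK : K ≤ e) (hL : L * 2 ^ K ≤ 2 * e) (he : 0 < e) :
    G.IsUnavoidable (4 * e) {x | G.IsRich K L x} := by
  classical
  intro C hC hdeg
  have := Fintype.ofFinite W
  have : Nonempty C := hC.to_subtype
  have hex : ∀ x : C, ∃ N : Finset C, (∀ y ∈ N, G.Adj x y) ∧ N.card = 4 * e := by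
    intro x
    have h1 : {y | G.Adj x y ∧ y ∈ C}.ncard =
        (Finset.univ.filter fun y : C => G.Adj x y).card := by
      rw [← Set.ncard_coe_finset, ← Set.ncard_image_of_injective _ Subtype.val_injective]
      congr 1
      ext y
      simp [and_comm]
    obtain ⟨N, hN, hcard⟩ := Finset.exists_subset_card_eq ((hdeg x x.2).trans h1.le)
    exact ⟨N, fun y hy => (Finset.mem_filter.1 (hN hy)).2, hcard⟩
  choose N hadj hN using hex
  obtain ⟨v, hv⟩ := exists_forall_path_avoiding hN hK hL he
  refine ⟨v, v.2, fun F hF => ?_⟩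
  obtain ⟨q, hq0, hq, hinj, hav⟩ := hv (F.subtype (· ∈ C))
    (by rw [Finset.card_subtype]; exact (Finset.card_filter_le _ _).trans hF)
  refine ⟨fun j => q j, by simp [hq0], fun j hj => hadj _ _ (hq j hj),
    fun i hi j hj h => hinj i hi j hj (Subtype.ext h), fun j h1 h2 hmem => hav j h1 h2 ?_⟩
  simpa using hmem

/-- If every vertex of `C` had fewer than `m` out-neighbours in `R`, then `C \ R` would keep
out-degrees above `d` and would have to meet `R`. -/
theorem IsUnavoidable.le_outNeighbors {W : Type u} [Finite W] {G : Digraph W} {d : ℕ} {R : Set W}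
    (hR : G.IsUnavoidable d R) (m : ℕ) :
    G.IsUnavoidable (d + m) {x | m ≤ {y | G.Adj x y ∧ y ∈ R}.ncard} := by
  intro C hC hdeg
  by_contra hemp
  have hlt : ∀ x ∈ C, {y | G.Adj x y ∧ y ∈ R}.ncard < m := fun x hx => by
    by_contra hge
    exact hemp ⟨x, hx, not_lt.1 hge⟩
  have hdeg' : ∀ x ∈ C, d < {y | G.Adj x y ∧ y ∈ C \ R}.ncard := by
    intro x hx
    have hsub : {y | G.Adj x y ∧ y ∈ C} ⊆
        {y | G.Adj x y ∧ y ∈ C \ R} ∪ {y | G.Adj x y ∧ y ∈ R} := fun y hy => by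
      by_cases hyR : y ∈ R
      · exact Or.inr ⟨hy.1, hyR⟩
      · exact Or.inl ⟨hy.1, hy.2, hyR⟩
    have h1 := (Set.ncard_le_ncard hsub (Set.toFinite _)).trans (Set.ncard_union_le _ _)
    have := hdeg x hx
    have := hlt x hx
    omega
  have hne : (C \ R).Nonempty := by
    obtain ⟨x, hx⟩ := hC
    obtain ⟨y, hy⟩ := Set.nonempty_of_ncard_ne_zero (Nat.ne_zero_of_lt (hdeg' x hx))
    exact ⟨y, hy.2⟩
  obtain ⟨y, hy, hyR⟩ := hR (C \ R) hne fun x hx => (hdeg' x hx.1).le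
  exact hy.2 hyR

/-- `G.outLevel m R j` consists of the roots of `m`-ary out-branching walks of length `j` that end
in `R`. -/
def outLevel {W : Type u} (G : Digraph W) (m : ℕ) (R : Set W) : ℕ → Set W
  | 0 => R
  | j + 1 => {x | m ≤ {y | G.Adj x y ∧ y ∈ G.outLevel m R j}.ncard}

theorem IsUnavoidable.outLevel {W : Type u} [Finite W] {G : Digraph W} {d : ℕ} {R : Set W}
    (hR : G.IsUnavoidable d R) (m j : ℕ) :
    G.IsUnavoidable (d + j * m) (G.outLevel m R j) := by
  induction j with
  | zero => simpa [Digraph.outLevel] using hR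
  | succ j ih =>
    rw [show d + (j + 1) * m = d + j * m + m by ring]
    exact ih.le_outNeighbors m

end Digraph

/-! ### Connected vertex sets in forests. -/

namespace SimpleGraph

variable {V : Type u} {S : SimpleGraph V}

lemma connected_induce_union_of_adj {A B : Set V} (hA : (S.induce A).Connected)
    (hB : (S.induce B).Connected) {a b : V} (ha : a ∈ A) (hb : b ∈ B) (hab : S.Adj a b) :
    (S.induce (A ∪ B)).Connected := by
  have h1 := induce_union_connected hA.preconnected
    (induce_pair_connected_of_adj hab).preconnected ⟨a, ha, by simp⟩
  have h2 := induce_union_connected h1.preconnected hB.preconnected ⟨b, by simp, hb⟩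
  have h3 : A ∪ {a, b} ∪ B = A ∪ B := by
    ext x
    simp only [Set.mem_union, Set.mem_insert_iff, Set.mem_singleton_iff]
    constructor
    · rintro ((h | rfl | rfl) | h) <;> simp_all
    · rintro (h | h) <;> simp_all
  rwa [h3] at h2

lemma reachable_deleteEdges_of_notMem {A : Set V} (hA : (S.induce A).Connected) {a b x y : V}
    (hb : b ∉ A) (hx : x ∈ A) (hy : y ∈ A) : (S.deleteEdges {s(a, b)}).Reachable x y := by
  let φ : S.induce A →g S.deleteEdges {s(a, b)} :=
    ⟨Subtype.val, fun {p q} hpq => by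
      rw [deleteEdges_adj]
      refine ⟨hpq, fun h => ?_⟩
      rcases Sym2.eq_iff.1 (Set.mem_singleton_iff.1 h) with ⟨-, h⟩ | ⟨h, -⟩
      · exact hb (h ▸ q.2)
      · exact hb (h ▸ p.2)⟩
  exact (hA.preconnected ⟨x, hx⟩ ⟨y, hy⟩).map φ

/-- Two connected sets of vertices of a forest, joined by an edge that lies in neither of them, are
disjoint and joined by this edge only. -/
lemma IsAcyclic.disjoint_and_forall_adj (hS : S.IsAcyclic) {A B : Set V}
    (hA : (S.induce A).Connected) (hB : (S.induce B).Connected) {a b : V} (ha : a ∈ A)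
    (hb : b ∈ B) (hbA : b ∉ A) (haB : a ∉ B) (hab : S.Adj a b) :
    Disjoint A B ∧ ∀ x ∈ A, ∀ y ∈ B, S.Adj x y → x = a ∧ y = b := by
  -- A common vertex or a second edge would join `a` to `b` without the bridge `ab`.
  have hbr := isBridge_iff.1 (isAcyclic_iff_forall_adj_isBridge.1 hS hab)
  have hA' : ∀ x ∈ A, (S.deleteEdges {s(a, b)}).Reachable a x := fun x hx =>
    reachable_deleteEdges_of_notMem hA hbA ha hx
  have hB' : ∀ x ∈ B, (S.deleteEdges {s(a, b)}).Reachable x b := fun x hx => by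
    rw [Sym2.eq_swap]
    exact reachable_deleteEdges_of_notMem hB haB hx hb
  refine ⟨Set.disjoint_left.2 fun x hx hx' => hbr ((hA' x hx).trans (hB' x hx')),
    fun x hx y hy hxy => ?_⟩
  by_contra hne
  refine hbr ((hA' x hx).trans (Reachable.trans (Adj.reachable ?_) (hB' y hy)))
  rw [deleteEdges_adj]
  refine ⟨hxy, fun h => ?_⟩
  rcases Sym2.eq_iff.1 (Set.mem_singleton_iff.1 h) with h | ⟨h, -⟩
  · exact hne h
  · exact hbA (h ▸ hx)

lemma Connected.exists_adj_mem_notMem (hS : S.Connected) {Y : Set V} {a b : V} (ha : a ∈ Y)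
    (hb : b ∉ Y) : ∃ y ∈ Y, ∃ z, z ∉ Y ∧ S.Adj y z := by
  obtain ⟨p⟩ := hS.preconnected a b
  obtain ⟨d, -, h1, h2⟩ := p.exists_boundary_dart Y ha hb
  exact ⟨d.fst, h1, d.snd, h2, d.adj⟩

end SimpleGraph

/-! ### Heights and ancestors in oriented trees. -/

namespace Digraph

open Relation (ReflTransGen)

variable {V : Type u} {W : Type v} {T : Digraph V} {G : Digraph W}

lemma IsOrientedTree.adj (hT : T.IsOrientedTree) {x y : V} (h : T.Adj x y) :
    T.toSimpleGraphInclusive.Adj x y := by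
  refine (SimpleGraph.fromRel_adj _ _ _).2 ⟨?_, Or.inl h⟩
  rintro rfl
  exact hT.1 _ _ h h

lemma adj_or_adj_of_toSimpleGraphInclusive {x y : V} (h : T.toSimpleGraphInclusive.Adj x y) :
    T.Adj x y ∨ T.Adj y x :=
  ((SimpleGraph.fromRel_adj _ _ _).1 h).2

lemma eq_of_adj_of_inDegree_lt [Finite V] {x p p' : V} (hx : T.inDegree x < 2)
    (hp : T.Adj p x) (hp' : T.Adj p' x) : p = p' :=
  (Set.ncard_le_one (Set.toFinite _)).1 (Nat.lt_succ_iff.1 hx) p hp p' hp'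

lemma IsHeightFunction.eq_or_lt {h : V → ℤ} (hh : T.IsHeightFunction h) {x y : V}
    (hxy : ReflTransGen T.Adj x y) : x = y ∨ h x < h y := by
  induction hxy with
  | refl => exact Or.inl rfl
  | tail _ hbc ih =>
    right
    have := hh _ _ hbc
    rcases ih with rfl | ih <;> omega

/-- The vertices from which `a` can be reached. -/
def ancestors (T : Digraph V) (a : V) : Set V := {b | ReflTransGen T.Adj b a}

lemma mem_ancestors_self (a : V) : a ∈ T.ancestors a := ReflTransGen.refl

lemma mem_ancestors_of_adj {a b c : V} (hb : b ∈ T.ancestors a) (hc : T.Adj c b) :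
    c ∈ T.ancestors a := ReflTransGen.head hc hb

lemma IsOrientedTree.connected_induce_ancestors (hT : T.IsOrientedTree) (a : V) :
    (T.toSimpleGraphInclusive.induce (T.ancestors a)).Connected := by
  rw [SimpleGraph.connected_iff_exists_forall_reachable]
  refine ⟨⟨a, mem_ancestors_self a⟩, ?_⟩
  rintro ⟨b, hb⟩
  refine SimpleGraph.Reachable.symm ?_
  induction hb using ReflTransGen.head_induction_on with
  | refl => exact SimpleGraph.Reachable.refl _
  | head hbc hc ih =>
    refine SimpleGraph.Reachable.trans (SimpleGraph.Adj.reachable ?_) ih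
    exact hT.adj hbc

/-- With unique in-neighbours the ancestors form one directed path, hence one vertex per height. -/
lemma IsHeightFunction.injOn_ancestors {h : V → ℤ} (hh : T.IsHeightFunction h) {a : V}
    (hdeg : ∀ b ∈ T.ancestors a, ∀ p p', T.Adj p b → T.Adj p' b → p = p') :
    Set.InjOn h (T.ancestors a) := by
  intro b hb
  induction hb using ReflTransGen.head_induction_on with
  | refl =>
    intro b' hb' heq
    rcases hh.eq_or_lt hb' with rfl | hlt
    · rfl
    · omega
  | head hbc hc ih =>
    rename_i b c
    intro b' hb' heq
    have h1 := hh _ _ hbc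
    rcases ReflTransGen.cases_head hb' with rfl | ⟨c', hbc', hc'⟩
    · rcases hh.eq_or_lt hc with rfl | hlt <;> omega
    · have h2 := hh _ _ hbc'
      have hcc : c = c' := ih hc' (by omega)
      subst hcc
      exact hdeg c hc _ _ hbc hbc'

/-- In an oriented tree in which only `u` and `v` may have in-degree greater than one, `u` and `v`
have a common ancestor. -/
lemma exists_common_ancestor (hT : T.IsOrientedTree) {u v : V}
    (hdeg : ∀ x, x ≠ u → x ≠ v → ∀ p p', T.Adj p x → T.Adj p' x → p = p') :
    ∃ w, w ∈ T.ancestors u ∧ w ∈ T.ancestors v := by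
  by_contra hcon
  -- An edge leaves the set of vertices sharing an ancestor with `u`; either direction of it puts
  -- `z` back in that set.
  obtain ⟨y, ⟨w, hwu, hwy⟩, z, hz, hyz⟩ := hT.2.connected.exists_adj_mem_notMem
    (Y := {y | ∃ w ∈ T.ancestors u, w ∈ T.ancestors y}) (a := u) (b := v)
    ⟨u, mem_ancestors_self u, mem_ancestors_self u⟩ hcon
  rcases adj_or_adj_of_toSimpleGraphInclusive hyz with hyz | hzy
  · exact hz ⟨w, hwu, ReflTransGen.tail hwy hyz⟩
  rcases ReflTransGen.cases_tail hwy with rfl | ⟨p, hwp, hpy⟩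
  · exact hz ⟨z, mem_ancestors_of_adj hwu hzy, mem_ancestors_self z⟩
  by_cases hyu : y = u
  · exact hz ⟨z, hyu ▸ ReflTransGen.single hzy, mem_ancestors_self z⟩
  have hyv : y ≠ v := by
    rintro rfl
    exact hcon ⟨w, hwu, hwy⟩
  obtain rfl := hdeg y hyu hyv p z hpy hzy
  exact hz ⟨w, hwu, hwp⟩

/-! ### Extending partial embeddings. -/

/-- `f` embeds the subgraph of `T` induced on `Y` into `G`. -/
def EmbedsOn (T : Digraph V) (G : Digraph W) (f : V → W) (Y : Set V) : Prop :=
  Set.InjOn f Y ∧ ∀ x ∈ Y, ∀ y ∈ Y, T.Adj x y → G.Adj (f x) (f y)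

lemma EmbedsOn.exists_union {f g : V → W} {Y B : Set V} (hf : T.EmbedsOn G f Y)
    (hg : T.EmbedsOn G g B) (hdisj : Disjoint Y B) (hne : ∀ y ∈ Y, ∀ b ∈ B, f y ≠ g b)
    (hYB : ∀ y ∈ Y, ∀ b ∈ B, T.Adj y b → G.Adj (f y) (g b))
    (hBY : ∀ y ∈ Y, ∀ b ∈ B, T.Adj b y → G.Adj (g b) (f y)) :
    ∃ f', T.EmbedsOn G f' (Y ∪ B) ∧ Set.EqOn f' f Y ∧ Set.EqOn f' g B := by
  classical
  have h1 : Set.EqOn (Y.piecewise f g) f Y := Set.piecewise_eqOn Y f g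
  have h2 : Set.EqOn (Y.piecewise f g) g B := fun b hb =>
    Set.piecewise_eq_of_notMem Y f g (Set.disjoint_right.1 hdisj hb)
  refine ⟨Y.piecewise f g, ⟨?_, ?_⟩, h1, h2⟩
  · rw [Set.injOn_union hdisj]
    refine ⟨hf.1.congr h1.symm, hg.1.congr h2.symm, fun y hy b hb => ?_⟩
    rw [h1 hy, h2 hb]
    exact hne y hy b hb
  · rintro x (hx | hx) y (hy | hy) hxy
    · rw [h1 hx, h1 hy]; exact hf.2 x hx y hy hxy
    · rw [h1 hx, h2 hy]; exact hYB x hx y hy hxy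
    · rw [h2 hx, h1 hy]; exact hBY y hy x hx hxy
    · rw [h2 hx, h2 hy]; exact hg.2 x hx y hy hxy

lemma EmbedsOn.exists_union_singleton (hT : T.IsOrientedTree) {f : V → W} {Y : Set V}
    (hf : T.EmbedsOn G f Y) (hY : (T.toSimpleGraphInclusive.induce Y).Connected) {y z : V}
    (hy : y ∈ Y) (hz : z ∉ Y) (hyz : T.Adj y z) {w : W} (hw : w ∉ f '' Y)
    (hadj : G.Adj (f y) w) :
    (T.toSimpleGraphInclusive.induce (Y ∪ {z})).Connected ∧
      ∃ f', T.EmbedsOn G f' (Y ∪ {z}) ∧ Set.EqOn f' f Y ∧ f' z = w := by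
  have hconn : (T.toSimpleGraphInclusive.induce {z}).Connected := by
    rw [SimpleGraph.induce_singleton_eq_top]
    exact SimpleGraph.connected_top
  obtain ⟨hdisj, hedge⟩ := hT.2.isAcyclic.disjoint_and_forall_adj hY hconn hy
    (Set.mem_singleton z) hz (by rintro rfl; exact hz hy) (hT.adj hyz)
  refine ⟨SimpleGraph.connected_induce_union_of_adj hY hconn hy rfl (hT.adj hyz), ?_⟩
  refine (hf.exists_union (g := fun _ => w) (B := {z}) ⟨Set.injOn_singleton _ _, ?_⟩ hdisj
    ?_ ?_ ?_).imp fun f' hf' => ⟨hf'.1, hf'.2.1, hf'.2.2 rfl⟩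
  · rintro a rfl b rfl h
    exact (hT.1 _ _ h h).elim
  · rintro x hx - - rfl
    exact hw ⟨x, hx, rfl⟩
  · intro x hx b hb hxb
    obtain ⟨rfl, -⟩ := hedge x hx b hb (hT.adj hxb)
    exact hadj
  · intro x hx b hb hbx
    obtain ⟨rfl, rfl⟩ := hedge x hx b hb (hT.adj hbx).symm
    exact (hT.1 _ _ hyz hbx).elim

lemma ncard_image_lt [Finite V] (f : V → W) {Y : Set V} {z : V} (hz : z ∉ Y) :
    (f '' Y).ncard < Nat.card V :=
  (Set.ncard_image_le (Set.toFinite _)).trans_lt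
    (Set.ncard_lt_card fun h => hz (h ▸ Set.mem_univ z))

lemma exists_mem_notMem_image [Finite V] (f : V → W) {Y : Set V} {z : V} (hz : z ∉ Y)
    {A : Set W} (hA : Nat.card V ≤ A.ncard) : ∃ w ∈ A, w ∉ f '' Y :=
  Set.exists_mem_notMem_of_ncard_lt_ncard ((ncard_image_lt f hz).trans_le hA)
    ((Set.toFinite Y).image f)

/-- Greedy embedding of the part `Q` of an oriented tree that can be grown from `r` along
out-edges, with the vertices of `Q` placed in prescribed levels. -/
lemma exists_embedsOn_outLevel [Finite V] (hT : T.IsOrientedTree) {R : Set W} {m : ℕ}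
    (hm : Nat.card V ≤ m) {n : V → ℕ} {Q : Set V} {r : V} (hr : r ∈ Q)
    (hn : ∀ x ∈ Q, ∀ y ∈ Q, T.Adj x y → n x = n y + 1)
    (hgrow : ∀ Y ⊆ Q, r ∈ Y → Y ≠ Q → ∃ y ∈ Y, ∃ z ∈ Q, z ∉ Y ∧ T.Adj y z)
    (hR : (G.outLevel m R (n r)).Nonempty) :
    (T.toSimpleGraphInclusive.induce Q).Connected ∧
      ∃ f, T.EmbedsOn G f Q ∧ ∀ y ∈ Q, f y ∈ G.outLevel m R (n y) := by
  obtain ⟨r', hr'⟩ := hR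
  obtain ⟨Y, ⟨hrY, hYQ, hconn, f, hf, hlev⟩, hmax⟩ :=
    (Set.toFinite {Y : Set V | r ∈ Y ∧ Y ⊆ Q ∧ (T.toSimpleGraphInclusive.induce Y).Connected ∧
      ∃ f, T.EmbedsOn G f Y ∧ ∀ y ∈ Y, f y ∈ G.outLevel m R (n y)}).exists_maximal
    ⟨{r}, rfl, by simpa using hr, by
      rw [SimpleGraph.induce_singleton_eq_top]
      exact SimpleGraph.connected_top, fun _ => r', ⟨Set.injOn_singleton _ _, by
        rintro a rfl b rfl h
        exact (hT.1 _ _ h h).elim⟩, by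
        rintro y rfl
        exact hr'⟩
  by_cases hne : Y = Q
  · subst hne
    exact ⟨hconn, f, hf, hlev⟩
  exfalso
  obtain ⟨y, hy, z, hzQ, hzY, hyz⟩ := hgrow Y hYQ hrY hne
  have hfy := hlev y hy
  rw [hn y (hYQ hy) z hzQ hyz] at hfy
  obtain ⟨w, ⟨hadj, hwlev⟩, hw⟩ := exists_mem_notMem_image f hzY (hm.trans hfy)
  obtain ⟨hconn', f', hf', h1, h2⟩ := hf.exists_union_singleton hT hconn hy hzY hyz hw hadj
  refine hzY (hmax (y := Y ∪ {z}) ⟨Or.inl hrY, Set.union_subset hYQ (by simpa using hzQ), hconn',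
    f', hf', ?_⟩ Set.subset_union_left (Or.inr rfl))
  rintro x (hx | rfl)
  · rw [h1 hx]; exact hlev x hx
  · rw [h2]; exact hwlev

/-- An embedding of `Y` extends by the ancestors of an in-neighbour of a vertex with rich image. -/
lemma EmbedsOn.exists_union_ancestors [Finite V] (hT : T.IsOrientedTree) {h : V → ℤ}
    (hh : T.IsHeightFunction h) {K : ℕ} (hK : ∀ a b, h a - h b ≤ K) {f : V → W} {Y : Set V}
    (hf : T.EmbedsOn G f Y) (hY : (T.toSimpleGraphInclusive.induce Y).Connected) {y z : V}
    (hy : y ∈ Y) (hz : z ∉ Y) (hzy : T.Adj z y)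
    (hdeg : ∀ x, x ∉ Y → ∀ p p', T.Adj p x → T.Adj p' x → p = p')
    (hrich : G.IsRich K (Nat.card V) (f y)) :
    (T.toSimpleGraphInclusive.induce (Y ∪ T.ancestors z)).Connected ∧
      ∃ f', T.EmbedsOn G f' (Y ∪ T.ancestors z) ∧ Set.EqOn f' f Y := by
  have hht := hh _ _ hzy
  have hle : ∀ b ∈ T.ancestors z, h b < h y := fun b hb => by
    rcases hh.eq_or_lt hb with rfl | hlt <;> omega
  have hyB : y ∉ T.ancestors z := fun hmem => lt_irrefl _ (hle y hmem)
  have hconn := hT.connected_induce_ancestors z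
  obtain ⟨hdisj, hedge⟩ := hT.2.isAcyclic.disjoint_and_forall_adj hY hconn hy
    (mem_ancestors_self z) hz hyB (hT.adj hzy).symm
  refine ⟨SimpleGraph.connected_induce_union_of_adj hY hconn hy (mem_ancestors_self z)
    (hT.adj hzy).symm, ?_⟩
  have hinj := hh.injOn_ancestors (a := z) fun b hb =>
    hdeg b (Set.disjoint_right.1 hdisj hb)
  have hfin : (f '' Y).Finite := (Set.toFinite Y).image f
  -- An ancestor `b` goes to the vertex of `q` that is `h y - h b` steps before `f y`.
  obtain ⟨q, hq0, hq, hqinj, hav⟩ := hrich hfin.toFinset (by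
    rw [← Set.ncard_eq_toFinset_card _ hfin]
    exact (ncard_image_lt f hz).le)
  have hidx : ∀ b ∈ T.ancestors z, 1 ≤ (h y - h b).toNat ∧ (h y - h b).toNat ≤ K := fun b hb => by
    have h1 := hle b hb
    have h2 := hK y b
    omega
  have hstep : ∀ b c, c = y ∨ c ∈ T.ancestors z → b ∈ T.ancestors z → T.Adj b c →
      G.Adj (q (h y - h b).toNat) (q (h y - h c).toNat) := fun b c hc hb hbc => by
    have h1 := hh _ _ hbc
    have h2 := hidx b hb
    have h3 : h c ≤ h y := by
      rcases hc with rfl | hc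
      · exact le_rfl
      · exact (hle c hc).le
    have h4 : (h y - h b).toNat = (h y - h c).toNat + 1 := by omega
    rw [h4]
    exact hq _ (by omega)
  refine (hf.exists_union (g := fun b => q (h y - h b).toNat) (B := T.ancestors z) ⟨?_, ?_⟩ hdisj
    ?_ ?_ ?_).imp fun f' hf' => ⟨hf'.1, hf'.2.1⟩
  · intro b hb c hc hbc
    have h1 := hqinj _ (hidx b hb).2 _ (hidx c hc).2 hbc
    have h2 := hle b hb
    have h3 := hle c hc
    exact hinj hb hc (by omega)
  · intro b hb c hc hbc
    exact hstep b c (Or.inr hc) hb hbc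
  · intro x hx b hb heq
    exact hav _ (hidx b hb).1 (hidx b hb).2 (by simpa using ⟨x, hx, heq⟩)
  · intro x hx b hb hxb
    obtain ⟨rfl, rfl⟩ := hedge x hx b hb (hT.adj hxb)
    exact (hT.1 _ _ hzy hxb).elim
  · intro x hx b hb hbx
    obtain ⟨rfl, rfl⟩ := hedge x hx b hb (hT.adj hbx).symm
    simpa [hq0] using hstep b x (Or.inl rfl) hb hbx

/-- An embedding of a connected part `Q` of an oriented tree extends to the whole tree if the
vertices of `Q` that miss an in-neighbour are mapped to rich vertices. -/
lemma containsSubgraph_of_embedsOn [Finite V] (hT : T.IsOrientedTree) {h : V → ℤ}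
    (hh : T.IsHeightFunction h) {K : ℕ} (hK : ∀ a b, h a - h b ≤ K)
    (hG : ∀ x, Nat.card V ≤ G.outDegree x) {Q : Set V} {f : V → W} (hf : T.EmbedsOn G f Q)
    (hQ : (T.toSimpleGraphInclusive.induce Q).Connected)
    (hdeg : ∀ x, x ∉ Q → ∀ p p', T.Adj p x → T.Adj p' x → p = p')
    (hrich : ∀ y ∈ Q, ∀ z, z ∉ Q → T.Adj z y → G.IsRich K (Nat.card V) (f y)) :
    G.ContainsSubgraph T := by
  -- Closure under in-neighbours outside `Q` ensures that an in-edge leaving `Y` ends in `Q`, where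
  -- richness is available.
  obtain ⟨Y, ⟨hQY, hconn, hclosed, f', hf', heq⟩, hmax⟩ :=
    (Set.toFinite {Y : Set V | Q ⊆ Y ∧ (T.toSimpleGraphInclusive.induce Y).Connected ∧
      (∀ y ∈ Y, y ∉ Q → ∀ p, T.Adj p y → p ∈ Y) ∧
      ∃ f', T.EmbedsOn G f' Y ∧ Set.EqOn f' f Q}).exists_maximal
    ⟨Q, subset_rfl, hQ, fun y hy hy' => (hy' hy).elim, f, hf, Set.eqOn_refl _ _⟩
  by_cases huniv : ∀ z, z ∈ Y
  · exact ⟨f', fun a b hab => hf'.1 (huniv a) (huniv b) hab,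
      fun a b hab => hf'.2 a (huniv a) b (huniv b) hab⟩
  exfalso
  push Not at huniv
  obtain ⟨b, hb⟩ := huniv
  obtain ⟨⟨a, ha⟩⟩ := hQ.nonempty
  obtain ⟨y, hy, z, hz, hadj⟩ := hT.2.connected.exists_adj_mem_notMem (hQY ha) hb
  rcases adj_or_adj_of_toSimpleGraphInclusive hadj with hyz | hzy
  · obtain ⟨w, hw, hwY⟩ := exists_mem_notMem_image f' hz (hG (f' y))
    obtain ⟨hconn', g, hg, h1, -⟩ :=
      hf'.exists_union_singleton hT hconn hy hz hyz hwY hw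
    refine hz (hmax (y := Y ∪ {z}) ⟨hQY.trans Set.subset_union_left, hconn', ?_, g, hg,
      fun x hx => (h1 (hQY hx)).trans (heq hx)⟩ Set.subset_union_left (Or.inr rfl))
    rintro x (hx | rfl) hxQ p hp
    · exact Or.inl (hclosed x hx hxQ p hp)
    · rw [hdeg x hxQ p y hp hyz]
      exact Or.inl hy
  · have hyQ : y ∈ Q := by
      by_contra hyQ
      exact hz (hclosed y hy hyQ z hzy)
    obtain ⟨hconn', g, hg, h1⟩ := hf'.exists_union_ancestors hT hh hK hconn hy hz hzy
      (fun x hx => hdeg x fun hxQ => hx (hQY hxQ))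
      (by rw [heq hyQ]; exact hrich y hyQ z (fun hzQ => hz (hQY hzQ)) hzy)
    refine hz (hmax (y := Y ∪ T.ancestors z) ⟨hQY.trans Set.subset_union_left, hconn', ?_, g, hg,
      fun x hx => (h1 (hQY hx)).trans (heq hx)⟩ Set.subset_union_left
      (Or.inr (mem_ancestors_self z)))
    rintro x (hx | hx) hxQ p hp
    · exact Or.inl (hclosed x hx hxQ p hp)
    · exact Or.inr (mem_ancestors_of_adj hx hp)

/-- Allowing `u = v`, or an arbitrary vertex when no in-degree reaches two, makes a single argument
cover all cases. -/
lemma exists_pair_of_ncard_le_two [Finite V] [Nonempty V] {h : V → ℤ}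
    (hU : {x : V | 2 ≤ T.inDegree x}.ncard ≤ 2)
    (hgr : ∀ x y : V, 2 ≤ T.inDegree x → 2 ≤ T.inDegree y → h x = h y) :
    ∃ u v, h u = h v ∧ ∀ x, x ≠ u → x ≠ v → T.inDegree x < 2 := by
  have key : ∀ u v, {x : V | 2 ≤ T.inDegree x} ⊆ {u, v} →
      ∀ x, x ≠ u → x ≠ v → T.inDegree x < 2 := fun u v hsub x hxu hxv => by
    by_contra hx
    rcases hsub (not_lt.1 hx) with h | h
    · exact hxu h
    · exact hxv h
  rcases Nat.lt_or_ge {x : V | 2 ≤ T.inDegree x}.ncard 2 with hlt | hge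
  · rcases Set.eq_empty_or_nonempty {x : V | 2 ≤ T.inDegree x} with he | ⟨u, hu⟩
    · exact ⟨Classical.arbitrary V, _, rfl, key _ _ (by rw [he]; exact Set.empty_subset _)⟩
    · exact ⟨u, u, rfl, key u u fun x hx => Or.inl
        ((Set.ncard_le_one (Set.toFinite _)).1 (Nat.lt_succ_iff.1 hlt) x hx u hu)⟩
  · obtain ⟨u, v, -, huv⟩ := Set.ncard_eq_two.1 (le_antisymm hU hge)
    have hu : u ∈ {x : V | 2 ≤ T.inDegree x} := by rw [huv]; exact Or.inl rfl
    have hv : v ∈ {x : V | 2 ≤ T.inDegree x} := by rw [huv]; exact Or.inr rfl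
    exact ⟨u, v, hgr u v hu hv, key u v huv.subset⟩

end Digraph

/-! ### Assembling the embedding. -/

theorem mainTheorem6 {V : Type u} [Finite V] (T : Digraph V) (hT : T.IsOrientedTree)
    (hgr : T.IsGrounded) (hU : {x : V | 2 ≤ T.inDegree x}.ncard ≤ 2) :
    Digraph.IsOutDegreeEnforcible.{u, v} T := by
  obtain ⟨h, hh, hground⟩ := hgr
  have : Nonempty V := hT.2.connected.nonempty
  obtain ⟨u, v, huv, hlt⟩ := Digraph.exists_pair_of_ncard_le_two hU hground
  have hdeg : ∀ x, x ≠ u → x ≠ v → ∀ p p', T.Adj p x → T.Adj p' x → p = p' :=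
    fun x hxu hxv p p' => Digraph.eq_of_adj_of_inDegree_lt (hlt x hxu hxv)
  obtain ⟨r, ⟨hru, hrv⟩, hmin⟩ := Set.exists_min_image (T.ancestors u ∩ T.ancestors v) h
    (Set.toFinite _) (Digraph.exists_common_ancestor hT hdeg)
  have hroot : ∀ p, ¬ T.Adj p r := fun p hp => by
    have h1 := hmin p ⟨Digraph.mem_ancestors_of_adj hru hp, Digraph.mem_ancestors_of_adj hrv hp⟩
    have h2 := hh _ _ hp
    omega
  obtain ⟨K, hK⟩ : ∃ K : ℕ, ∀ a b, h a - h b ≤ K := by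
    obtain ⟨M, hM⟩ := (Set.finite_range fun p : V × V => h p.1 - h p.2).bddAbove
    exact ⟨M.toNat, fun a b => (hM ⟨(a, b), rfl⟩).trans (Int.self_le_toNat M)⟩
  set Q : Set V := {y | r ∈ T.ancestors y ∧ (y ∈ T.ancestors u ∨ y ∈ T.ancestors v)}
  have hQu : ∀ y ∈ Q, h y ≤ h u := by
    rintro y ⟨-, hy | hy⟩
    · rcases hh.eq_or_lt hy with rfl | hy <;> omega
    · rcases hh.eq_or_lt hy with rfl | hy <;> omega
  have huQ : u ∈ Q := ⟨hru, Or.inl (Digraph.mem_ancestors_self u)⟩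
  have hvQ : v ∈ Q := ⟨hrv, Or.inr (Digraph.mem_ancestors_self v)⟩
  have hrQ : r ∈ Q := ⟨Digraph.mem_ancestors_self r, Or.inl hru⟩
  have hpred : ∀ y ∈ Q, ∀ p, T.Adj p y → r ∈ T.ancestors p → p ∈ Q := fun y hy p hp hr =>
    ⟨hr, hy.2.imp (fun h => Digraph.mem_ancestors_of_adj h hp)
      fun h => Digraph.mem_ancestors_of_adj h hp⟩
  have hgrow : ∀ Y ⊆ Q, r ∈ Y → Y ≠ Q → ∃ y ∈ Y, ∃ z ∈ Q, z ∉ Y ∧ T.Adj y z := by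
    intro Y hYQ hrY hne
    by_contra! hcon
    refine hne (hYQ.antisymm fun z hz => ?_)
    have aux : ∀ z, Relation.ReflTransGen T.Adj r z → z ∈ Q → z ∈ Y := by
      intro z hrz
      induction hrz with
      | refl => exact fun _ => hrY
      | tail hrp hpz ih =>
        intro hzQ
        by_contra hzY
        exact hcon _ (ih (hpred _ hzQ _ hpz hrp)) _ hzQ hzY hpz
    exact aux z hz.1 hz
  set m := Nat.card V
  -- Depth above the rich level: no truncation occurs on `Q`, and `u` and `v` both get depth 0.
  set n : V → ℕ := fun x => (h u - h x).toNat with hn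
  set e := K + m * 2 ^ K + 1
  -- Rich vertices cost `4 * e`; each of the `n r` branching levels costs `m` more.
  refine ⟨4 * e + n r * m, fun W _ _ G _ hG => ?_⟩
  have hout : ∀ x, 4 * e + n r * m ≤ G.outDegree x := fun x =>
    hG.trans (ciInf_le (OrderBot.bddBelow _) x)
  have hunav := (G.isUnavoidable_isRich (K := K) (L := m) (e := e) (by omega) (by omega)
    (by omega)).outLevel m (n r)
  have hne : (G.outLevel m {x | G.IsRich K m x} (n r)).Nonempty := by
    have := hunav Set.univ Set.univ_nonempty fun x _ => by
      simpa [Digraph.outDegree] using hout x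
    simpa using this
  obtain ⟨hconn, f, hf, hlev⟩ := Digraph.exists_embedsOn_outLevel hT le_rfl hrQ
    (fun x hx y hy hxy => by
      have h1 := hh _ _ hxy
      have h2 := hQu y hy
      simp only [hn]
      omega) hgrow hne
  have hrich : ∀ y, h y = h u → y ∈ Q → G.IsRich K m (f y) := fun y hy hyQ => by
    have h1 := hlev y hyQ
    have h2 : n y = 0 := by simp [hn, hy]
    rw [h2] at h1
    exact h1
  have hmle : m ≤ 4 * e := by
    have : m * 1 ≤ m * 2 ^ K := Nat.mul_le_mul_left _ Nat.one_le_two_pow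
    omega
  refine Digraph.containsSubgraph_of_embedsOn hT hh hK
    (fun x => hmle.trans ((Nat.le_add_right _ _).trans (hout x))) hf hconn
    (fun x hx => hdeg x (fun h => hx (h ▸ huQ)) fun h => hx (h ▸ hvQ)) ?_
  intro y hy z hz hzy
  by_cases hyu : y = u
  · exact hrich y (by rw [hyu]) hy
  by_cases hyv : y = v
  · exact hrich y (by rw [hyv, huv]) hy
  exfalso
  -- Any other `y` in `Q` is the source `r` or has its only in-neighbour on the path from `r`, hence
  -- in `Q`.
  rcases Relation.ReflTransGen.cases_tail hy.1 with rfl | ⟨p, hrp, hpy⟩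
  · exact hroot z hzy
  · exact hz (hdeg y hyu hyv p z hpy hzy ▸ hpred y hy p hpy hrp)
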